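/- Let $n>r>0$ be integers and $k:=n-r$. Consider the $r\times k$ grid of boxes, with rows numbered from the top and columns from the left. The dual quiver has one interior vertex for each box and two external vertices, one above the top left box and one to the right of the bottom right box. Its arrows go from the upper external vertex to the top left box, from the bottom right box to the right external vertex, from each box to the next box to the right in its row, and from each box to the box directly below it. Let $M=\mathbb{Z}^{rk}$ with basis $e'_v$ indexed by the boxes $v$, set $e'_v=0$ for external vertices $v$, and for an arrow $a$ with source $s(a)$ and target $t(a)$ put $w_a:=-e'_{s(a)}+e'_{t(a)}$. The Gelfand--Cetlin polytope is $P_{n,r}:=\operatorname{conv}\{w_a\}\subset M_{\mathbb{R}}$, a lattice polytope with respect to $M$. Let $N=M^\vee$ and $P_{n,r}^\vee:=\{f\in N_{\mathbb{R}}: f(w)\ge -1 \text{ for all } w\in P_{n,r}\}$. The primitive dual $Q_{n,r}$ is the polytope $P_{n,r}^\vee$ regarded as a polytope with respect to the lattice $\overline{M}\subset N_{\mathbb R}$ generated by its vertices. For each box $v$ let $a_v$ be the arrow from $v$ to the right if there is one, and otherwise the arrow from $v$ downwards; the vectors $b_v:=w_{a_v}$ form a basis of $M$, with dual basis $b_v^\vee$.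 Let $\mathcal{P}(n,r)$ be the set of partitions whose Young diagram fits into the $r\times k$ grid (placed in its top left corner). A partition $\lambda$ crosses an arrow $a$ if $s(a)$ is a box of $\lambda$ or the upper external vertex, while $t(a)$ is a box outside $\lambda$ or the right external vertex; that is, if the lattice path bounding $\lambda$ separates $s(a)$ from $t(a)$. Put $$v_\lambda:=n\,m_\lambda-h,\qquad m_\lambda:=\sum_{v:\ \lambda\text{ crosses }a_v} b_v^\vee,\qquad h:=\sum_v b_v^\vee .$$ Label the arrows of the dual quiver by partitions as follows. The arrow whose source is external is labelled $(k^r)$, and the arrow whose target is external is labelled $\emptyset$. The $a$-th (from the right) of the $k-1$ horizontal arrows between boxes in the $b$-th row from the bottom is labelled $\nu_{a,b-1}$, and the $a$-th (from the bottom) of the $r-1$ vertical arrows between boxes in the $b$-th column from the right is labelled $\mu_{a-1,b}$. Here $\mu_{a,b}$ is the partition $(k,\dots,k,b)$ with $a$ parts equal to $k$, and $\nu_{a,b}$ is the partition whose transpose is $(r,\dots,r,b)$ with $a$ parts equal to $r$. Let $\mathcal{A}(n,r)\subset\mathcal{P}(n,r)$, the set of arrow partitions, be the set of all these labels. **Theorem.**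 The points $v_\lambda$, $\lambda\in\mathcal{P}(n,r)$, are pairwise distinct and are exactly the vertices of $Q_{n,r}$. Let $\overline{Q}_{n,r}:=\operatorname{conv}\{v_\lambda:\lambda\in\mathcal{A}(n,r)\}$ be the polytope obtained by deleting the vertices $v_\lambda$ with $\lambda\notin\mathcal{A}(n,r)$. Then $P_{n,r}$ (with lattice $M$) and $\overline{Q}_{n,r}$ (with lattice $\overline{M}$) are isomorphic as lattice polytopes: both are lattice polytopes, and there is an isomorphism of lattices $M\to\overline{M}$ whose real extension maps $P_{n,r}$ onto $\overline{Q}_{n,r}$. -/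

import Mathlib

/-! ## Lattice polytopes -/

/-- `Λ` is a full-rank lattice in the real vector space `V`: the integer span of a real basis. -/
def IsFullLattice {V : Type*} [AddCommGroup V] [Module ℝ V] (Λ : Submodule ℤ V) : Prop :=
  ∃ (d : ℕ) (b : Module.Basis (Fin d) ℝ V), Λ = Submodule.span ℤ (Set.range b)

/-- `P` is a lattice polytope with respect to the lattice `Λ`: the convex hull of finitely many
points of `Λ`. -/
def IsLatticePolytope {V : Type*} [AddCommGroup V] [Module ℝ V]
    (Λ : Submodule ℤ V) (P : Set V) : Prop :=
  IsFullLattice Λ ∧ ∃ S : Finset V, (S : Set V) ⊆ (Λ : Set V) ∧ P = convexHull ℝ (S : Set V)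

/-- The lattice polytopes `P` (with lattice `Λ`) and `P'` (with lattice `Λ'`) are isomorphic:
the real extension of some isomorphism of lattices `Λ ≃ Λ'` maps `P` onto `P'`. -/
def LatticePolytopesIsomorphic {V V' : Type*} [AddCommGroup V] [Module ℝ V]
    [AddCommGroup V'] [Module ℝ V']
    (Λ : Submodule ℤ V) (P : Set V) (Λ' : Submodule ℤ V') (P' : Set V') : Prop :=
  IsLatticePolytope Λ P ∧ IsLatticePolytope Λ' P' ∧
    ∃ T : V ≃ₗ[ℝ] V', T '' (Λ : Set V) = (Λ' : Set V') ∧ T '' P = P'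

/-- The dual of a polytope: all linear functionals that are at least `-1` on `P`. -/
def dualPolytope {V : Type*} [AddCommGroup V] [Module ℝ V] (P : Set V) :
    Set (Module.Dual ℝ V) :=
  {f | ∀ w ∈ P, -1 ≤ f w}

/-- The lattice generated by the vertices of the dual polytope of `P`. The primitive dual of `P`
is the polytope `dualPolytope P`, regarded as a polytope with respect to this lattice. -/
def primitiveDualLattice {V : Type*} [AddCommGroup V] [Module ℝ V] (P : Set V) :
    Submodule ℤ (Module.Dual ℝ V) :=
  Submodule.span ℤ ((dualPolytope P).extremePoints ℝ)

namespace Ladder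

/-! ## The dual quiver of the `r × k` ladder diagram, and its polytope -/

/-- The boxes of the `r × k` grid, that is, the interior vertices of the dual quiver.
Rows are numbered from the top and columns from the left. -/
abbrev Cell (r k : ℕ) : Type := Fin r × Fin k

/-- The vertices of the dual quiver: the boxes, an external vertex above the top left box, and an
external vertex to the right of the bottom right box. -/
inductive DualVertex (r k : ℕ) : Type
  | above : DualVertex r k
  | right : DualVertex r k
  | cell (v : Cell r k) : DualVertex r k

/-- The arrows of the dual quiver: the arrow from the upper external vertex to the top left box,
the arrow from the bottom right box to the right external vertex, an arrow from each box to the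
next one in its row, and an arrow from each box to the one below it. -/
inductive DualArrow (r k : ℕ) : Type
  | fromAbove (hr : 0 < r) (hk : 0 < k) : DualArrow r k
  | toRight (hr : 0 < r) (hk : 0 < k) : DualArrow r k
  | horizontal (i j : ℕ) (hi : i < r) (hj : j + 1 < k) : DualArrow r k
  | vertical (i j : ℕ) (hi : i + 1 < r) (hj : j < k) : DualArrow r k

def DualArrow.source {r k : ℕ} : DualArrow r k → DualVertex r k
  | .fromAbove _ _ => .above
  | .toRight hr hk => .cell (⟨r - 1, by omega⟩, ⟨k - 1, by omega⟩)
  | .horizontal i j hi hj => .cell (⟨i, hi⟩, ⟨j, by omega⟩)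
  | .vertical i j hi hj => .cell (⟨i, by omega⟩, ⟨j, hj⟩)

def DualArrow.target {r k : ℕ} : DualArrow r k → DualVertex r k
  | .fromAbove hr hk => .cell (⟨0, hr⟩, ⟨0, hk⟩)
  | .toRight _ _ => .right
  | .horizontal i j hi hj => .cell (⟨i, hi⟩, ⟨j + 1, hj⟩)
  | .vertical i j hi hj => .cell (⟨i + 1, hi⟩, ⟨j, hj⟩)

/-- The vector `e'_v`: a standard basis vector for an interior vertex, zero for an external one. -/
def vertexVector {r k : ℕ} : DualVertex r k → (Cell r k → ℝ)
  | .above => 0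
  | .right => 0
  | .cell v => Pi.single v 1

/-- The vector `w_a = -e'_{s(a)} + e'_{t(a)}`. -/
def arrowVector {r k : ℕ} (a : DualArrow r k) : Cell r k → ℝ :=
  -vertexVector a.source + vertexVector a.target

/-- The lattice `M = ℤ^(r × k)`, inside `ℝ^(r × k)`. -/
def standardLattice (r k : ℕ) : Submodule ℤ (Cell r k → ℝ) :=
  Submodule.span ℤ (Set.range fun v : Cell r k => Pi.single (M := fun _ => ℝ) v 1)

/-- The Gelfand–Cetlin polytope `P_{n,r}`, where `n = r + k`. -/
def gelfandCetlinPolytope (r k : ℕ) : Set (Cell r k → ℝ) :=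
  convexHull ℝ (Set.range fun a : DualArrow r k => arrowVector a)

/-- The arrow `a_v`: the horizontal arrow out of `v` if there is one, and otherwise the vertical
arrow out of `v`. -/
def outArrow {r k : ℕ} (v : Cell r k) : DualArrow r k :=
  if hj : (v.2 : ℕ) + 1 < k then .horizontal v.1 v.2 v.1.isLt hj
  else if hi : (v.1 : ℕ) + 1 < r then .vertical v.1 v.2 hi v.2.isLt
  else .toRight (Nat.zero_lt_of_lt v.1.isLt) (Nat.zero_lt_of_lt v.2.isLt)

theorem single_mem_span_outArrow {r k : ℕ} (m : ℕ) (v : Cell r k)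
    (hm : (r - v.1) + (k - v.2) ≤ m) :
    (Pi.single v 1 : Cell r k → ℝ) ∈
      Submodule.span ℝ (Set.range fun v : Cell r k => arrowVector (outArrow v)) := by
  induction m generalizing v with
  | zero => have := v.1.isLt; omega
  | succ m ih =>
    obtain ⟨⟨i, hi⟩, ⟨j, hj⟩⟩ := v
    have hb := Submodule.subset_span (R := ℝ)
      (Set.mem_range_self (f := fun v : Cell r k => arrowVector (outArrow v)) (⟨i, hi⟩, ⟨j, hj⟩))
    set B : Set (Cell r k → ℝ) := Set.range fun v : Cell r k => arrowVector (outArrow v)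
    simp only at hm
    by_cases h1 : j + 1 < k
    · have h2 := ih (⟨i, hi⟩, ⟨j + 1, h1⟩) (by simp only; omega)
      simp only [outArrow, h1, dite_true, arrowVector, DualArrow.source, DualArrow.target,
        vertexVector] at hb
      simpa using Submodule.sub_mem _ h2 hb
    · by_cases h3 : i + 1 < r
      · have h2 := ih (⟨i + 1, h3⟩, ⟨j, hj⟩) (by simp only; omega)
        simp only [outArrow, h1, h3, dite_true, dite_false, arrowVector, DualArrow.source,
          DualArrow.target, vertexVector] at hb
        simpa using Submodule.sub_mem _ h2 hb
      · have e1 : i = r - 1 := by omega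
        have e2 : j = k - 1 := by omega
        subst e1 e2
        simp only [outArrow, h1, h3, dite_false, arrowVector, DualArrow.source,
          DualArrow.target, vertexVector, add_zero] at hb
        simpa using Submodule.neg_mem _ hb

theorem top_le_span_outArrow (r k : ℕ) :
    ⊤ ≤ Submodule.span ℝ (Set.range fun v : Cell r k => arrowVector (outArrow v)) := by
  rw [← (Pi.basisFun ℝ (Cell r k)).span_eq, Submodule.span_le]
  rintro _ ⟨v, rfl⟩
  rw [Pi.basisFun_apply]
  exact single_mem_span_outArrow _ v le_rfl

/-- The basis `b_v = w_{a_v}`. -/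
noncomputable def arrowBasis (r k : ℕ) : Module.Basis (Cell r k) ℝ (Cell r k → ℝ) :=
  basisOfTopLeSpanOfCardEqFinrank (fun v : Cell r k => arrowVector (outArrow v))
    (top_le_span_outArrow r k) (by simp)

/-! ## Partitions and the vertices of the primitive dual -/

/-- Partitions that fit into an `r × k` box, as weakly decreasing sequences of `r` numbers that are
at most `k`. -/
@[ext]
structure BoxPartition (r k : ℕ) : Type where
  parts : Fin r → ℕ
  antitone : Antitone parts
  parts_le : ∀ i, parts i ≤ k

/-- The vertex lies above the lattice path, from the bottom left to the top right corner, whose area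
above it is the Young diagram of `p`. -/
def BoxPartition.IsAbove {r k : ℕ} (p : BoxPartition r k) : DualVertex r k → Prop
  | .above => True
  | .right => False
  | .cell v => (v.2 : ℕ) < p.parts v.1

/-- The lattice path of `p` crosses the arrow `a` of the dual quiver. (Arrows go right and down, so
they can cross the path only from above to below.) -/
def BoxPartition.Crosses {r k : ℕ} (p : BoxPartition r k) (a : DualArrow r k) : Prop :=
  p.IsAbove a.source ∧ ¬ p.IsAbove a.target

open Classical in
/-- The functional `m_p`, the sum of `b_v^∨` over all boxes `v` such that `p` crosses `a_v`. -/
noncomputable def pathFunctional {r k : ℕ} (p : BoxPartition r k) :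
    Module.Dual ℝ (Cell r k → ℝ) :=
  ∑ v : Cell r k with p.Crosses (outArrow v), (arrowBasis r k).coord v

/-- The functional `h`, the sum of all `b_v^∨`. -/
noncomputable def shiftFunctional (r k : ℕ) : Module.Dual ℝ (Cell r k → ℝ) :=
  ∑ v : Cell r k, (arrowBasis r k).coord v

/-- The vertex `v_p = n m_p - h` of the primitive dual `Q_{n,r}`, where `n = r + k`. -/
noncomputable def primitiveDualVertex {r k : ℕ} (p : BoxPartition r k) :
    Module.Dual ℝ (Cell r k → ℝ) :=
  ((r + k : ℕ) : ℝ) • pathFunctional p - shiftFunctional r k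

/-! ## Arrow partitions -/

/-- The partition `μ_{a,b} = (k, …, k, b)` with `a` parts equal to `k`. -/
def muPartition {r k : ℕ} (a b : ℕ) (hb : b ≤ k) : BoxPartition r k where
  parts i := if (i : ℕ) < a then k else if (i : ℕ) = a then b else 0
  antitone := by
    intro i j hij
    have : (i : ℕ) ≤ j := hij
    simp only
    split_ifs <;> omega
  parts_le i := by
    split_ifs <;> omega

/-- The partition `ν_{a,b}` whose transpose is `(r, …, r, b)` with `a` parts equal to `r`: the first
`b` rows have length `a + 1` and the other rows have length `a`. -/
def nuPartition {r k : ℕ} (a b : ℕ) (ha : a < k) : BoxPartition r k where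
  parts i := if (i : ℕ) < b then a + 1 else a
  antitone := by
    intro i j hij
    have : (i : ℕ) ≤ j := hij
    simp only
    split_ifs <;> omega
  parts_le i := by
    split_ifs <;> omega

/-- The partition `(k^r)`. -/
def fullPartition (r k : ℕ) : BoxPartition r k where
  parts _ := k
  antitone := antitone_const
  parts_le _ := le_rfl

/-- The empty partition. -/
def emptyPartition (r k : ℕ) : BoxPartition r k where
  parts _ := 0
  antitone := antitone_const
  parts_le _ := Nat.zero_le _

/-- The labelling of the arrows of the dual quiver by partitions. The `a`-th of the `k - 1`
horizontal arrows between boxes, from the right, in the `b`-th row from the bottom is labelled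
`ν_{a,b-1}`; the `a`-th of the `r - 1` vertical arrows between boxes, from the bottom, in the `b`-th
column from the right is labelled `μ_{a-1,b}`. -/
def arrowLabel {r k : ℕ} : DualArrow r k → BoxPartition r k
  | .fromAbove _ _ => fullPartition r k
  | .toRight _ _ => emptyPartition r k
  | .horizontal i j _ _ => nuPartition (k - 1 - j) (r - 1 - i) (by omega)
  | .vertical i j _ _ => muPartition (r - 2 - i) (k - j) (by omega)

/-- The set `A(n,r)` of arrow partitions, where `n = r + k`. -/
def arrowPartitions (r k : ℕ) : Set (BoxPartition r k) :=
  Set.range arrowLabel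

/-- The polytope obtained from `Q_{n,r}` by deleting the vertices of the excess partitions. -/
def truncatedPrimitiveDual (r k : ℕ) : Set (Module.Dual ℝ (Cell r k → ℝ)) :=
  convexHull ℝ (primitiveDualVertex '' arrowPartitions r k)

end Ladder

namespace Ladder

variable {r k : ℕ}

/-! ## The dual quiver -/

/-! Write `y d = f(e'_d) + height d`. Every arrow raises `height` by one, so `f(w_a) ≥ -1` says
exactly that `y` does not decrease along `a`, with `y = 0` at the upper and `y = n` at the right
external vertex. The dual polytope is thus `n` times the order polytope of the grid, whose vertices
are the monotone functions with values `0` and `n`; their zero sets are the Young diagrams, and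
`v_λ` is the vertex that vanishes on `λ` (`range_primitiveDualVertex`).

The isomorphism sends `w_a` to `v_λ` with `λ` the label of `a`. The `w_a` are linearly dependent, so
this needs a potential on the quiver whose difference along each arrow is that `v_λ`. It exists
because the number of labels avoiding a given box, counted along a path to the right external
vertex, does not depend on the path (`pathCount_source`).

It remains to see that the arrow partitions already generate the lattice of all `v_λ`. Adding one
box `c` to a partition changes `v_λ` by `n` times the dual vector of `c`, and these multiples all
come from arrow partitions (`boxFunctional_mem`). This also makes the map bijective. -/

instance : Finite (DualArrow r k) := by
  let f : DualArrow r k → Fin 4 × Fin (r + 1) × Fin (k + 1) := fun a => match a with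
    | .fromAbove _ _ => (0, 0, 0)
    | .toRight _ _ => (1, 0, 0)
    | .horizontal i j _ _ => (2, ⟨i, by omega⟩, ⟨j, by omega⟩)
    | .vertical i j _ _ => (3, ⟨i, by omega⟩, ⟨j, by omega⟩)
  refine Finite.of_injective f ?_
  rintro (_ | _ | _ | _) (_ | _ | _ | _) h <;> simp_all [f]

/-- The length of any path in the dual quiver from the upper external vertex. -/
def height : DualVertex r k → ℝ
  | .above => 0
  | .right => r + k
  | .cell v => v.1 + v.2 + 1

theorem height_target (a : DualArrow r k) : height a.target = height a.source + 1 := by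
  cases a with
  | fromAbove hr hk => simp [height, DualArrow.target, DualArrow.source]
  | toRight hr hk =>
    simp only [height, DualArrow.target, DualArrow.source]
    rw [Nat.cast_sub (by omega), Nat.cast_sub (by omega)]
    push_cast; ring
  | horizontal i j hi hj =>
    simp only [height, DualArrow.target, DualArrow.source]
    push_cast; ring
  | vertical i j hi hj =>
    simp only [height, DualArrow.target, DualArrow.source]
    push_cast; ring

theorem map_arrowVector {W : Type*} [AddCommGroup W] [Module ℝ W]
    (f : (Cell r k → ℝ) →ₗ[ℝ] W) (a : DualArrow r k) :
    f (arrowVector a) = f (vertexVector a.target) - f (vertexVector a.source) := by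
  simp only [arrowVector, map_add, map_neg]; abel

theorem arrowBasis_apply (v : Cell r k) : arrowBasis r k v = arrowVector (outArrow v) := by
  simp [arrowBasis]

theorem dual_ext {f g : Module.Dual ℝ (Cell r k → ℝ)}
    (h : ∀ v, f (vertexVector (.cell v)) = g (vertexVector (.cell v))) : f = g :=
  (Pi.basisFun ℝ (Cell r k)).ext fun v => by
    simpa only [Pi.basisFun_apply, vertexVector] using h v

/-- The functional with prescribed values on the vectors of the boxes. -/
noncomputable def functional (y : Cell r k → ℝ) : Module.Dual ℝ (Cell r k → ℝ) :=
  (Pi.basisFun ℝ (Cell r k)).constr ℝ y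

theorem functional_vertexVector (y : Cell r k → ℝ) (v : Cell r k) :
    functional y (vertexVector (.cell v)) = y v := by
  have := (Pi.basisFun ℝ (Cell r k)).constr_basis ℝ y v
  rwa [Pi.basisFun_apply] at this

theorem dual_vertexVector_ext {f : Module.Dual ℝ (Cell r k → ℝ)} {y : DualVertex r k → ℝ}
    (ha : y .above = 0) (hr : y .right = 0)
    (hc : ∀ v, f (vertexVector (.cell v)) = y (.cell v)) (d : DualVertex r k) :
    f (vertexVector d) = y d := by
  cases d with
  | above => simp [vertexVector, ha]
  | right => simp [vertexVector, hr]
  | cell v => exact hc v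

/-! ## The points `v_p` -/

theorem BoxPartition.IsAbove.source (p : BoxPartition r k) (a : DualArrow r k)
    (h : p.IsAbove a.target) : p.IsAbove a.source := by
  cases a with
  | fromAbove hr hk => trivial
  | toRight hr hk => exact h.elim
  | horizontal i j hi hj =>
    simp only [IsAbove, DualArrow.target, DualArrow.source] at h ⊢
    omega
  | vertical i j hi hj =>
    simp only [IsAbove, DualArrow.target, DualArrow.source] at h ⊢
    exact h.trans_le (p.antitone (by simp))

open Classical in
/-- The function that is `0` above the lattice path of `p`, and `n` below it. -/
noncomputable def pathValue (p : BoxPartition r k) (d : DualVertex r k) : ℝ :=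
  if p.IsAbove d then 0 else r + k

theorem pathValue_cell (p : BoxPartition r k) (v : Cell r k) :
    pathValue p (.cell v) = if (v.2 : ℕ) < p.parts v.1 then 0 else (r + k : ℝ) := by
  simp only [pathValue, BoxPartition.IsAbove]
  congr

/-- Both functionals take the value `n - 1` or `-1` on `b_u`, according to whether `p` crosses
`a_u`: `pathValue` jumps by `n` exactly there, since arrows cross only from above to below. -/
theorem primitiveDualVertex_vertexVector (p : BoxPartition r k) (d : DualVertex r k) :
    primitiveDualVertex p (vertexVector d) = pathValue p d - height d := by
  classical
  have hf : ∀ d, functional (fun v => pathValue p (.cell v) - height (.cell v)) (vertexVector d)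
      = pathValue p d - height d :=
    dual_vertexVector_ext (by simp [pathValue, height, BoxPartition.IsAbove])
      (by simp [pathValue, height, BoxPartition.IsAbove]) fun v => functional_vertexVector _ v
  rw [← hf]
  congr 1
  refine (arrowBasis r k).ext fun u => ?_
  have h1 : primitiveDualVertex p (arrowBasis r k u) =
      (r + k) * (if p.Crosses (outArrow u) then 1 else 0) - 1 := by
    simp [primitiveDualVertex, pathFunctional, shiftFunctional, LinearMap.sum_apply,
      Module.Basis.coord_apply, Module.Basis.repr_self, Finsupp.single_apply, Finset.sum_ite_eq]
  rw [h1, arrowBasis_apply, map_arrowVector, hf, hf, height_target]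
  have := BoxPartition.IsAbove.source p (outArrow u)
  simp only [BoxPartition.Crosses, pathValue]
  by_cases ht : p.IsAbove (outArrow u).target
  · simp only [this ht, ht, not_true, and_false, if_true, if_false]; ring
  · by_cases hs : p.IsAbove (outArrow u).source
    · simp only [hs, ht, not_false_iff, and_self, if_true, if_false]; ring
    · simp only [hs, ht, not_false_iff, and_true, if_false]; ring

theorem primitiveDualVertex_injective (hr : 0 < r) :
    Function.Injective (primitiveDualVertex (r := r) (k := k)) := by
  intro p q h
  have key : ∀ v : Cell r k, (v.2 : ℕ) < p.parts v.1 ↔ (v.2 : ℕ) < q.parts v.1 := by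
    intro v
    have h1 := congrArg (fun f => f (vertexVector (.cell v))) h
    simp only [primitiveDualVertex_vertexVector, pathValue_cell] at h1
    have : (0 : ℝ) < r + k := by positivity
    split_ifs at h1 with hp hq hq
    · exact iff_of_true hp hq
    · linarith
    · linarith
    · exact iff_of_false hp hq
  ext i
  have hp := p.parts_le i
  have hq := q.parts_le i
  rcases lt_trichotomy (p.parts i) (q.parts i) with hlt | heq | hlt
  · exact absurd ((key (i, ⟨p.parts i, by omega⟩)).2 hlt) (by simp)
  · exact heq
  · exact absurd ((key (i, ⟨q.parts i, by omega⟩)).1 hlt) (by simp)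

/-! ## The dual of the Gelfand–Cetlin polytope -/

theorem dualPolytope_convexHull {V : Type*} [AddCommGroup V] [Module ℝ V] (S : Set V) :
    dualPolytope (convexHull ℝ S) = dualPolytope S := by
  refine Set.Subset.antisymm (fun f hf w hw => hf w (subset_convexHull ℝ S hw)) fun f hf w hw => ?_
  exact convexHull_min (t := {w | -1 ≤ f w}) hf (convex_halfSpace_ge f.isLinear _) hw

/-- The coordinates in which the dual polytope becomes a multiple of an order polytope. -/
noncomputable def orderCoord (f : Module.Dual ℝ (Cell r k → ℝ)) (d : DualVertex r k) : ℝ :=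
  f (vertexVector d) + height d

theorem orderCoord_above (f : Module.Dual ℝ (Cell r k → ℝ)) : orderCoord f .above = 0 := by
  simp [orderCoord, height, vertexVector]

theorem orderCoord_right (f : Module.Dual ℝ (Cell r k → ℝ)) : orderCoord f .right = r + k := by
  simp [orderCoord, height, vertexVector]

theorem orderCoord_primitiveDualVertex (p : BoxPartition r k) (d : DualVertex r k) :
    orderCoord (primitiveDualVertex p) d = pathValue p d := by
  simp [orderCoord, primitiveDualVertex_vertexVector]

theorem orderCoord_combination (f g : Module.Dual ℝ (Cell r k → ℝ)) {a b : ℝ} (hab : a + b = 1)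
    (d : DualVertex r k) :
    orderCoord (a • f + b • g) d = a * orderCoord f d + b * orderCoord g d := by
  simp only [orderCoord, LinearMap.add_apply, LinearMap.smul_apply, smul_eq_mul]
  linear_combination (-height d) * hab

theorem orderCoord_ext {f g : Module.Dual ℝ (Cell r k → ℝ)}
    (h : ∀ v, orderCoord f (.cell v) = orderCoord g (.cell v)) : f = g :=
  dual_ext fun v => by simpa [orderCoord] using h v

theorem exists_orderCoord_eq (y : DualVertex r k → ℝ) (ha : y .above = 0)
    (hr : y .right = r + k) :
    ∃ f : Module.Dual ℝ (Cell r k → ℝ), ∀ d, orderCoord f d = y d := by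
  refine ⟨functional fun v => y (.cell v) - height (.cell v), fun d => ?_⟩
  have := dual_vertexVector_ext (f := functional fun v => y (.cell v) - height (.cell v))
    (y := fun d => y d - height d) (by simp [ha, height]) (by simp [hr, height])
    (fun v => functional_vertexVector _ v) d
  rw [orderCoord, this, sub_add_cancel]

/-- It suffices to test `f ≥ -1` on the generators `w_a`, and the unit increase of `height` absorbs
the `-1`. -/
theorem mem_dualPolytope_iff (f : Module.Dual ℝ (Cell r k → ℝ)) :
    f ∈ dualPolytope (gelfandCetlinPolytope r k) ↔
      ∀ a : DualArrow r k, orderCoord f a.source ≤ orderCoord f a.target := by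
  rw [gelfandCetlinPolytope, dualPolytope_convexHull]
  simp only [dualPolytope, Set.mem_ofPred_eq, Set.forall_mem_range, map_arrowVector, orderCoord,
    height_target]
  exact forall_congr' fun a => ⟨fun h => by linarith, fun h => by linarith⟩

theorem orderCoord_mono {f : Module.Dual ℝ (Cell r k → ℝ)}
    (hf : f ∈ dualPolytope (gelfandCetlinPolytope r k)) {i i' j j' : ℕ} (hi : i ≤ i')
    (hj : j ≤ j') (hi' : i' < r) (hj' : j' < k) :
    orderCoord f (.cell (⟨i, by omega⟩, ⟨j, by omega⟩)) ≤
      orderCoord f (.cell (⟨i', hi'⟩, ⟨j', hj'⟩)) := by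
  rw [mem_dualPolytope_iff] at hf
  induction i', hi using Nat.le_induction with
  | base =>
    induction j', hj using Nat.le_induction with
    | base => exact le_rfl
    | succ j' hj ih => exact (ih (by omega)).trans (hf (.horizontal i j' hi' hj'))
  | succ i' hi ih => exact (ih (by omega)).trans (hf (.vertical i' j' hi' hj'))

theorem orderCoord_nonneg {f : Module.Dual ℝ (Cell r k → ℝ)}
    (hf : f ∈ dualPolytope (gelfandCetlinPolytope r k)) (v : Cell r k) :
    0 ≤ orderCoord f (.cell v) := by
  have hr := Nat.zero_lt_of_lt v.1.isLt
  have hk := Nat.zero_lt_of_lt v.2.isLt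
  have h1 := (mem_dualPolytope_iff f).1 hf (.fromAbove hr hk)
  rw [← orderCoord_above f]
  exact h1.trans (orderCoord_mono hf (Nat.zero_le _) (Nat.zero_le _) v.1.isLt v.2.isLt)

theorem orderCoord_le {f : Module.Dual ℝ (Cell r k → ℝ)}
    (hf : f ∈ dualPolytope (gelfandCetlinPolytope r k)) (v : Cell r k) :
    orderCoord f (.cell v) ≤ r + k := by
  have hr := Nat.zero_lt_of_lt v.1.isLt
  have hk := Nat.zero_lt_of_lt v.2.isLt
  have h1 := (mem_dualPolytope_iff f).1 hf (.toRight hr hk)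
  rw [← orderCoord_right f]
  exact (orderCoord_mono hf (i := v.1) (j := v.2) (by omega) (by omega) _ _).trans h1

/-! ### Extreme points of the dual polytope. -/

theorem primitiveDualVertex_mem_dualPolytope (p : BoxPartition r k) :
    primitiveDualVertex p ∈ dualPolytope (gelfandCetlinPolytope r k) := by
  rw [mem_dualPolytope_iff]
  intro a
  simp only [orderCoord_primitiveDualVertex, pathValue]
  have := BoxPartition.IsAbove.source p a
  split_ifs with hs ht ht
  · exact le_rfl
  · positivity
  · exact absurd (this ht) hs
  · exact le_rfl

/-- All box coordinates on the dual polytope lie in `[0, n]`, and those of `v_p` sit at the ends of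
this interval, so no proper convex combination can produce them. -/
theorem primitiveDualVertex_mem_extremePoints (p : BoxPartition r k) :
    primitiveDualVertex p ∈ (dualPolytope (gelfandCetlinPolytope r k)).extremePoints ℝ := by
  refine mem_extremePoints.2 ⟨primitiveDualVertex_mem_dualPolytope p, fun f hf g hg hfg => ?_⟩
  obtain ⟨a, b, ha, hb, hab, h⟩ := hfg
  have key : ∀ v, orderCoord f (.cell v) = pathValue p (.cell v) ∧
      orderCoord g (.cell v) = pathValue p (.cell v) := by
    intro v
    have h1 := orderCoord_combination f g hab (.cell v)
    rw [h, orderCoord_primitiveDualVertex] at h1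
    have f0 := orderCoord_nonneg hf v
    have f1 := orderCoord_le hf v
    have g0 := orderCoord_nonneg hg v
    have g1 := orderCoord_le hg v
    unfold pathValue at h1 ⊢
    split_ifs at h1 ⊢
    · constructor <;> nlinarith [mul_nonneg ha.le f0, mul_nonneg hb.le g0]
    · have hb' : b = 1 - a := by linarith
      subst hb'
      constructor <;> nlinarith [mul_nonneg ha.le (sub_nonneg.2 f1),
        mul_nonneg hb.le (sub_nonneg.2 g1)]
  constructor <;> refine orderCoord_ext fun v => ?_
  · rw [orderCoord_primitiveDualVertex, (key v).1]
  · rw [orderCoord_primitiveDualVertex, (key v).2]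

theorem orderCoord_eq_zero_or_eq {f : Module.Dual ℝ (Cell r k → ℝ)}
    (hf : f ∈ (dualPolytope (gelfandCetlinPolytope r k)).extremePoints ℝ) (v : Cell r k) :
    orderCoord f (.cell v) = 0 ∨ orderCoord f (.cell v) = r + k := by
  have hn : (0 : ℝ) ≤ r + k := by positivity
  -- `f` is the midpoint of the truncations `min(2y, n)` and `max(0, 2y - n)`, which are again
  -- monotone with the right boundary values. Extremality gives `y = min(2y, n)`, so `y` is `0` or
  -- `n`.
  obtain ⟨g, hg⟩ := exists_orderCoord_eq (fun d => min (2 * orderCoord f d) (r + k))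
    (by simp [orderCoord_above, hn])
    (by rw [orderCoord_right]; exact min_eq_right (by linarith))
  obtain ⟨g', hg'⟩ := exists_orderCoord_eq (fun d => max 0 (2 * orderCoord f d - (r + k)))
    (by rw [orderCoord_above]; exact max_eq_left (by linarith))
    (by rw [orderCoord_right]; rw [max_eq_right] <;> linarith)
  obtain ⟨hfm, hfe⟩ := mem_extremePoints.1 hf
  have hmono := (mem_dualPolytope_iff f).1 hfm
  have hgm : g ∈ dualPolytope (gelfandCetlinPolytope r k) := by
    rw [mem_dualPolytope_iff]
    intro a
    rw [hg, hg]
    exact min_le_min_right _ (by linarith [hmono a])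
  have hgm' : g' ∈ dualPolytope (gelfandCetlinPolytope r k) := by
    rw [mem_dualPolytope_iff]
    intro a
    rw [hg', hg']
    exact max_le_max_left _ (by linarith [hmono a])
  have hseg : f ∈ openSegment ℝ g g' := by
    refine ⟨1 / 2, 1 / 2, by norm_num, by norm_num, by norm_num, orderCoord_ext fun v => ?_⟩
    rw [orderCoord_combination _ _ (by norm_num), hg, hg']
    rcases le_total (2 * orderCoord f (.cell v)) (r + k) with h | h
    · rw [min_eq_left h, max_eq_left (by linarith)]; ring
    · rw [min_eq_right h, max_eq_right (by linarith)]; ring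
  have h1 := hg (.cell v)
  rw [(hfe g hgm g' hgm' hseg).1] at h1
  rcases le_total (2 * orderCoord f (.cell v)) (r + k) with h | h
  · rw [min_eq_left h] at h1; left; linarith
  · rw [min_eq_right h] at h1; exact Or.inr h1

theorem exists_lt_iff_of_antitone {k : ℕ} (S : Fin k → Prop) (hS : ∀ i j, i ≤ j → S j → S i) :
    ∃ m ≤ k, ∀ j : Fin k, (j : ℕ) < m ↔ S j := by
  classical
  -- `m` is the first index outside `S`; the value `k` qualifies vacuously, which covers the case
  -- that `S` holds everywhere.
  have hex : ∃ m, ∀ h : m < k, ¬ S ⟨m, h⟩ := ⟨k, fun h => absurd h (lt_irrefl _)⟩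
  refine ⟨Nat.find hex, Nat.find_min' hex fun h => absurd h (lt_irrefl _), fun j => ⟨fun hj => ?_,
    fun hj => ?_⟩⟩
  · have := Nat.find_min hex hj
    push Not at this
    exact this.2
  · by_contra hlt
    push Not at hlt
    exact Nat.find_spec hex (hlt.trans_lt j.isLt) (hS _ _ hlt hj)

theorem exists_boxPartition (S : Cell r k → Prop) (hS : ∀ u v, u ≤ v → S v → S u) :
    ∃ p : BoxPartition r k, ∀ v : Cell r k, (v.2 : ℕ) < p.parts v.1 ↔ S v := by
  choose m hm h using fun i : Fin r => exists_lt_iff_of_antitone (fun j => S (i, j))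
    fun j j' hj => hS _ _ ⟨le_rfl, hj⟩
  refine ⟨⟨m, fun i i' hi => ?_, hm⟩, fun v => h v.1 v.2⟩
  by_contra hlt
  push Not at hlt
  have hk : m i < k := hlt.trans_le (hm i')
  exact lt_irrefl _ ((h i ⟨m i, hk⟩).2 (hS (i, ⟨m i, hk⟩) (i', ⟨m i, hk⟩) ⟨hi, le_rfl⟩
    ((h i' ⟨m i, hk⟩).1 hlt)))

theorem range_primitiveDualVertex (hr : 0 < r) :
    Set.range (primitiveDualVertex (r := r) (k := k)) =
      (dualPolytope (gelfandCetlinPolytope r k)).extremePoints ℝ := by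
  refine Set.Subset.antisymm (Set.range_subset_iff.2 primitiveDualVertex_mem_extremePoints)
    fun f hf => ?_
  have h01 := orderCoord_eq_zero_or_eq hf
  have hn : (0 : ℝ) < r + k := by positivity
  obtain ⟨p, hp⟩ := exists_boxPartition (fun v : Cell r k => orderCoord f (.cell v) = 0)
    fun u v huv hv => le_antisymm (hv ▸ orderCoord_mono hf.1 huv.1 huv.2 v.1.isLt v.2.isLt)
      (orderCoord_nonneg hf.1 u)
  refine ⟨p, orderCoord_ext fun v => ?_⟩
  rw [orderCoord_primitiveDualVertex]
  simp only [pathValue_cell, hp]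
  split_ifs with h
  · exact h.symm
  · exact ((h01 v).resolve_left h).symm

/-! ## The isomorphism -/

/-- The number of arrows, on any path from `d` to the right external vertex, whose labels do not
contain the box `v`. -/
def pathCount (d : DualVertex r k) (v : Cell r k) : ℕ :=
  match d with
  | .above => v.1 + v.2 + 1
  | .right => 0
  | .cell u => 1 + min (v.1 : ℕ) (r - 1 - u.1) +
      min (v.2 : ℕ) (k - 1 - u.2 + if (v.1 : ℕ) < r - 1 - u.1 then 1 else 0)

/-- This is path independence. The closed formula for a box counts along the path that goes down
first and then right in the bottom row: the last arrow gives `1`, the vertical arrows the first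
minimum and the indicator's contribution, the bottom row the rest. -/
theorem pathCount_source (a : DualArrow r k) (v : Cell r k) :
    pathCount a.source v = pathCount a.target v +
      if (v.2 : ℕ) < (arrowLabel a).parts v.1 then 0 else 1 := by
  obtain ⟨⟨p, hp⟩, ⟨q, hq⟩⟩ := v
  split_ifs with h <;> rcases a with ⟨_, _⟩ | ⟨_, _⟩ | ⟨i, j, _, _⟩ | ⟨i, j, _, _⟩ <;>
  · simp only [pathCount, DualArrow.source, DualArrow.target, arrowLabel, fullPartition,
      emptyPartition, nuPartition, muPartition] at h ⊢
    split_ifs at h ⊢ <;> omega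

/-- The linear map that sends `w_a` to the point labelled by the label of `a`. -/
noncomputable def mirrorMap (r k : ℕ) : (Cell r k → ℝ) →ₗ[ℝ] Module.Dual ℝ (Cell r k → ℝ) :=
  (Pi.basisFun ℝ (Cell r k)).constr ℝ fun u => functional fun v =>
    (r + k - height (.cell u)) * height (.cell v) - (r + k) * pathCount (.cell u) v

/-- The formula is minus the sum of `n [v ∉ λ] - height v` over the labels `λ` on a path from `d` to
the right external vertex; such a path has `n - height d` arrows. It vanishes at both external
vertices, as a linear map requires. -/
theorem mirrorMap_vertexVector (d : DualVertex r k) (v : Cell r k) :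
    mirrorMap r k (vertexVector d) (vertexVector (.cell v)) =
      (r + k - height d) * height (.cell v) - (r + k) * pathCount d v := by
  cases d with
  | above => simp [vertexVector, height, pathCount]
  | right => simp [vertexVector, height, pathCount]
  | cell u =>
    have := (Pi.basisFun ℝ (Cell r k)).constr_basis ℝ (fun u => functional fun v : Cell r k =>
      (r + k - height (.cell u)) * height (.cell v) - (r + k) * pathCount (.cell u) v) u
    rw [Pi.basisFun_apply] at this
    rw [mirrorMap, vertexVector, this, functional_vertexVector]

theorem mirrorMap_arrowVector (a : DualArrow r k) :
    mirrorMap r k (arrowVector a) = primitiveDualVertex (arrowLabel a) := by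
  refine dual_ext fun v => ?_
  rw [map_arrowVector, LinearMap.sub_apply, mirrorMap_vertexVector, mirrorMap_vertexVector,
    primitiveDualVertex_vertexVector, pathCount_source, height_target]
  simp only [pathValue_cell]
  split_ifs <;> push_cast <;> ring

/-! ## The lattices -/

theorem span_arrowVector : Submodule.span ℤ (Set.range (arrowVector (r := r) (k := k))) =
    standardLattice r k := by
  have hsingle : ∀ v : Cell r k, Pi.single v 1 ∈ standardLattice r k := fun v =>
    Submodule.subset_span ⟨v, rfl⟩
  have hvert : ∀ d : DualVertex r k, vertexVector d ∈ standardLattice r k := by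
    rintro (_ | _ | v)
    · exact zero_mem _
    · exact zero_mem _
    · exact hsingle v
  refine le_antisymm (Submodule.span_le.2 ?_) (Submodule.span_le.2 ?_)
  · rintro _ ⟨a, rfl⟩
    exact add_mem (neg_mem (hvert _)) (hvert _)
  · rintro _ ⟨⟨⟨i, hi⟩, ⟨j, hj⟩⟩, rfl⟩
    -- Walk from the upper external vertex, whose vector is zero, and add one `w_a` per arrow.
    have step : ∀ a : DualArrow r k,
        vertexVector a.source ∈ Submodule.span ℤ (Set.range (arrowVector (r := r) (k := k))) →
        vertexVector a.target ∈ Submodule.span ℤ (Set.range (arrowVector (r := r) (k := k))) := by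
      intro a ha
      have := add_mem ha (Submodule.subset_span (R := ℤ) (Set.mem_range_self (f := arrowVector) a))
      rwa [arrowVector, add_neg_cancel_left] at this
    change vertexVector (.cell (⟨i, hi⟩, ⟨j, hj⟩)) ∈ _
    induction i with
    | zero =>
      induction j with
      | zero => exact step (.fromAbove hi hj) (zero_mem _)
      | succ j ih => exact step (.horizontal 0 j hi hj) (ih (by omega))
    | succ i ih => exact step (.vertical i j hi hj) (ih (by omega))

/-- The lattice generated by the points labelled by arrow partitions. -/
noncomputable def arrowLattice (r k : ℕ) : Submodule ℤ (Module.Dual ℝ (Cell r k → ℝ)) :=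
  Submodule.span ℤ (primitiveDualVertex '' arrowPartitions r k)

theorem map_standardLattice :
    (standardLattice r k).map ((mirrorMap r k).restrictScalars ℤ) = arrowLattice r k := by
  rw [← span_arrowVector, Submodule.map_span, arrowLattice, arrowPartitions, ← Set.range_comp,
    ← Set.range_comp]
  congr 2
  ext a : 1
  exact mirrorMap_arrowVector a

/-! ### Arrow partitions generate the whole lattice. -/

/-- `n` times the dual basis vector of a box. -/
noncomputable def boxFunctional (c : Cell r k) : Module.Dual ℝ (Cell r k → ℝ) :=
  functional fun v => if v = c then (r + k : ℝ) else 0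

theorem boxFunctional_eq_sub (c : Cell r k) (p q : BoxPartition r k)
    (h : ∀ v : Cell r k, (v.2 : ℕ) < q.parts v.1 ↔ (v.2 : ℕ) < p.parts v.1 ∨ v = c)
    (hc : ¬ (c.2 : ℕ) < p.parts c.1) :
    boxFunctional c = primitiveDualVertex p - primitiveDualVertex q := by
  refine dual_ext fun v => ?_
  rw [boxFunctional, functional_vertexVector, LinearMap.sub_apply,
    primitiveDualVertex_vertexVector, primitiveDualVertex_vertexVector]
  simp only [pathValue_cell, h]
  by_cases hv : v = c
  · subst hv; simp [hc]
  · simp [hv]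

open Classical in
theorem primitiveDualVertex_eq_sub_sum (p : BoxPartition r k) :
    primitiveDualVertex p = primitiveDualVertex (emptyPartition r k) -
      ∑ c : Cell r k with (c.2 : ℕ) < p.parts c.1, boxFunctional c := by
  refine dual_ext fun v => ?_
  rw [LinearMap.sub_apply, LinearMap.sum_apply, primitiveDualVertex_vertexVector,
    primitiveDualVertex_vertexVector]
  simp only [boxFunctional, functional_vertexVector, pathValue_cell, emptyPartition,
    Finset.sum_ite_eq, Finset.mem_filter, Finset.mem_univ, true_and]
  split_ifs <;> first | omega | ring

theorem primitiveDualVertex_arrowLabel_mem (a : DualArrow r k) :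
    primitiveDualVertex (arrowLabel a) ∈ arrowLattice r k :=
  Submodule.subset_span ⟨_, ⟨a, rfl⟩, rfl⟩

theorem emptyPartition_mem (hr : 0 < r) (hk : 0 < k) :
    primitiveDualVertex (emptyPartition r k) ∈ arrowLattice r k :=
  primitiveDualVertex_arrowLabel_mem (.toRight hr hk)

theorem fullPartition_mem (hr : 0 < r) (hk : 0 < k) :
    primitiveDualVertex (fullPartition r k) ∈ arrowLattice r k :=
  primitiveDualVertex_arrowLabel_mem (.fromAbove hr hk)

theorem muPartition_mem (a b : ℕ) (ha : a + 1 < r) (hb : b ≤ k) (hk : 0 < k) :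
    primitiveDualVertex (muPartition (r := r) a b hb) ∈ arrowLattice r k := by
  have hpos : ∀ (a b : ℕ) (_ : a + 1 < r) (hb : b ≤ k), 0 < b →
      primitiveDualVertex (muPartition (r := r) a b hb) ∈ arrowLattice r k := by
    intro a b ha hb hb0
    convert primitiveDualVertex_arrowLabel_mem
      (.vertical (r := r) (k := k) (r - 2 - a) (k - b) (by omega) (by omega)) using 2
    simp only [arrowLabel]
    congr 1 <;> omega
  -- Vertical arrows only give labels with `b ≥ 1`; otherwise `μ_{0,0} = ∅` and `μ_{a+1,0} =
  -- μ_{a,k}`.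
  rcases Nat.eq_zero_or_pos b with rfl | hb0
  · rcases a with _ | a
    · convert emptyPartition_mem (by omega : 0 < r) hk using 2
      ext i
      simp [muPartition, emptyPartition]
    · convert hpos a k (by omega) le_rfl hk using 2
      ext i
      simp only [muPartition]
      split_ifs <;> omega
  · exact hpos a b ha hb hb0

theorem nuPartition_mem (a b : ℕ) (ha0 : 0 < a) (ha : a < k) (hb : b < r) :
    primitiveDualVertex (nuPartition (r := r) a b ha) ∈ arrowLattice r k := by
  convert primitiveDualVertex_arrowLabel_mem
    (.horizontal (r := r) (k := k) (r - 1 - b) (k - 1 - a) (by omega) (by omega)) using 2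
  simp only [arrowLabel]
  congr 1 <;> omega

/-- Above the bottom row, a box `(p, q)` is the difference of `μ_{p,q+1}` and `μ_{p,q}`. In the
bottom row it is the last box of a full column: the difference of `ν_{q+1,0}`, or `(k^r)` in the
last column, and `ν_{q,r-1}`. The latter is an arrow label only for `q > 0`, which excludes the
bottom left corner. -/
theorem boxFunctional_mem_of_ne (c : Cell r k) (hc : ¬ ((c.1 : ℕ) + 1 = r ∧ (c.2 : ℕ) = 0)) :
    boxFunctional c ∈ arrowLattice r k := by
  obtain ⟨⟨p, hp⟩, ⟨q, hq⟩⟩ := c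
  simp only at hc
  by_cases hp' : p + 1 < r
  · rw [boxFunctional_eq_sub _ (muPartition p q hq.le) (muPartition p (q + 1) hq)]
    · exact sub_mem (muPartition_mem _ _ hp' _ (by omega)) (muPartition_mem _ _ hp' _ (by omega))
    · rintro ⟨⟨i, hi⟩, ⟨j, hj⟩⟩
      simp only [muPartition, Prod.mk.injEq, Fin.mk.injEq]
      split_ifs <;> omega
    · simp [muPartition]
  · have hsub : ∀ s : BoxPartition r k, (∀ i, s.parts i = q + 1) →
        boxFunctional (⟨p, hp⟩, ⟨q, hq⟩) =
          primitiveDualVertex (nuPartition q (r - 1) hq) - primitiveDualVertex s := by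
      intro s hs
      refine boxFunctional_eq_sub _ _ _ ?_ ?_
      · rintro ⟨⟨i, hi⟩, ⟨j, hj⟩⟩
        simp only [hs, nuPartition, Prod.mk.injEq, Fin.mk.injEq]
        split_ifs <;> omega
      · simp only [nuPartition]
        split_ifs <;> omega
    by_cases hq' : q + 1 < k
    · rw [hsub (nuPartition (q + 1) 0 hq') (by simp [nuPartition])]
      exact sub_mem (nuPartition_mem _ _ (by omega) _ (by omega))
        (nuPartition_mem _ _ (by omega) _ (by omega))
    · rw [hsub (fullPartition r k) (by simp only [fullPartition]; omega)]
      exact sub_mem (nuPartition_mem _ _ (by omega) _ (by omega))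
        (fullPartition_mem (by omega) (by omega))

theorem boxFunctional_mem (c : Cell r k) : boxFunctional c ∈ arrowLattice r k := by
  classical
  by_cases hc : (c.1 : ℕ) + 1 = r ∧ (c.2 : ℕ) = 0
  · have hr := Nat.zero_lt_of_lt c.1.isLt
    have hk := Nat.zero_lt_of_lt c.2.isLt
    -- The corner is what remains of `v_∅ - v_(k^r)`, the sum over all boxes, once the other boxes
    -- are removed.
    have h := primitiveDualVertex_eq_sub_sum (fullPartition r k)
    have hall : (Finset.univ.filter fun c : Cell r k =>
        (c.2 : ℕ) < (fullPartition r k).parts c.1) = Finset.univ := by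
      ext v; simp [fullPartition]
    rw [hall, ← Finset.add_sum_erase _ _ (Finset.mem_univ c)] at h
    have hrest : ∑ x ∈ Finset.univ.erase c, boxFunctional x ∈ arrowLattice r k := by
      refine sum_mem fun x hx => boxFunctional_mem_of_ne x fun hx' => (Finset.mem_erase.1 hx).1 ?_
      exact Prod.ext (Fin.ext (by omega)) (Fin.ext (by omega))
    have : boxFunctional c = primitiveDualVertex (emptyPartition r k) -
        primitiveDualVertex (fullPartition r k) - ∑ x ∈ Finset.univ.erase c, boxFunctional x := by
      rw [h]; abel
    rw [this]
    exact sub_mem (sub_mem (emptyPartition_mem hr hk) (fullPartition_mem hr hk)) hrest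
  · exact boxFunctional_mem_of_ne c hc

theorem primitiveDualVertex_mem_arrowLattice (hr : 0 < r) (hk : 0 < k) (p : BoxPartition r k) :
    primitiveDualVertex p ∈ arrowLattice r k := by
  classical
  rw [primitiveDualVertex_eq_sub_sum]
  exact sub_mem (emptyPartition_mem hr hk) (sum_mem fun c _ => boxFunctional_mem c)

theorem primitiveDualLattice_eq_arrowLattice (hr : 0 < r) (hk : 0 < k) :
    primitiveDualLattice (gelfandCetlinPolytope r k) = arrowLattice r k := by
  rw [primitiveDualLattice, ← range_primitiveDualVertex hr]
  refine le_antisymm (Submodule.span_le.2 ?_) (Submodule.span_mono (Set.image_subset_range _ _))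
  rintro _ ⟨p, rfl⟩
  exact primitiveDualVertex_mem_arrowLattice hr hk p

/-- The image of the standard lattice contains `n` times the dual basis, which spans over the reals.
-/
theorem mirrorMap_surjective (hr : 0 < r) : Function.Surjective (mirrorMap r k) := by
  have hn : (r + k : ℝ) ≠ 0 := by positivity
  have hbox : ∀ c : Cell r k, boxFunctional c ∈ LinearMap.range (mirrorMap r k) := by
    intro c
    have := boxFunctional_mem c
    rw [← map_standardLattice] at this
    obtain ⟨x, -, hx⟩ := this
    exact ⟨x, hx⟩
  rw [← LinearMap.range_eq_top, eq_top_iff]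
  intro f _
  have hf : f = ∑ c : Cell r k, (f (vertexVector (.cell c)) / (r + k)) • boxFunctional c := by
    refine dual_ext fun v => ?_
    simp only [LinearMap.sum_apply, LinearMap.smul_apply, boxFunctional, functional_vertexVector,
      smul_eq_mul, mul_ite, mul_zero, Finset.sum_ite_eq, Finset.mem_univ, if_true]
    field_simp
  rw [hf]
  exact sum_mem fun c _ => Submodule.smul_mem _ _ (hbox c)

/-- The isomorphism that sends `w_a` to the point labelled by the label of `a`. -/
noncomputable def mirrorEquiv (hr : 0 < r) :
    (Cell r k → ℝ) ≃ₗ[ℝ] Module.Dual ℝ (Cell r k → ℝ) :=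
  LinearEquiv.ofBijective (mirrorMap r k)
    ⟨(LinearMap.injective_iff_surjective_of_finrank_eq_finrank
      Subspace.dual_finrank_eq.symm).2 (mirrorMap_surjective hr), mirrorMap_surjective hr⟩

/-! ### Transport of the lattice and of the polytope. -/

theorem mirrorEquiv_image_standardLattice (hr : 0 < r) :
    mirrorEquiv (k := k) hr '' (standardLattice r k : Set (Cell r k → ℝ)) =
      (arrowLattice r k : Set (Module.Dual ℝ (Cell r k → ℝ))) := by
  rw [← map_standardLattice]
  rfl

theorem mirrorEquiv_image_polytope (hr : 0 < r) :
    mirrorEquiv (k := k) hr '' gelfandCetlinPolytope r k = truncatedPrimitiveDual r k := by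
  rw [gelfandCetlinPolytope, truncatedPrimitiveDual, arrowPartitions, ← Set.range_comp]
  refine ((mirrorMap r k).image_convexHull _).trans ?_
  rw [← Set.range_comp]
  congr 2
  ext a : 1
  exact mirrorMap_arrowVector a

theorem isLatticePolytope_gelfandCetlinPolytope :
    IsLatticePolytope (standardLattice r k) (gelfandCetlinPolytope r k) := by
  refine ⟨⟨_, (Pi.basisFun ℝ (Cell r k)).reindex (Fintype.equivFin _), ?_⟩,
    (Set.finite_range (arrowVector (r := r) (k := k))).toFinset, ?_, ?_⟩
  · rw [Module.Basis.range_reindex, standardLattice]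
    congr 2
    ext v : 1
    exact (Pi.basisFun_apply ℝ _ v).symm
  · rw [Set.Finite.coe_toFinset, ← span_arrowVector]
    exact Submodule.subset_span
  · rw [Set.Finite.coe_toFinset, gelfandCetlinPolytope]

end Ladder

/-- Transport along the isomorphism yields that the lattice of the primitive dual has full rank and
that the truncated polytope is a lattice polytope, without a separate argument. -/
theorem IsLatticePolytope.map {V V' : Type*} [AddCommGroup V] [Module ℝ V]
    [AddCommGroup V'] [Module ℝ V'] {Λ : Submodule ℤ V} {P : Set V} {Λ' : Submodule ℤ V'}
    {P' : Set V'} (h : IsLatticePolytope Λ P) (T : V ≃ₗ[ℝ] V')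
    (hΛ : T '' (Λ : Set V) = (Λ' : Set V')) (hP : T '' P = P') : IsLatticePolytope Λ' P' := by
  classical
  obtain ⟨⟨d, b, rfl⟩, S, hS, rfl⟩ := h
  refine ⟨⟨d, b.map T, SetLike.coe_injective ?_⟩, S.image T, ?_, ?_⟩
  · rw [← hΛ]
    have h1 := Submodule.map_span ((T : V →ₗ[ℝ] V').restrictScalars ℤ) (Set.range b)
    have h2 : Set.range (b.map T) = (T : V →ₗ[ℝ] V').restrictScalars ℤ '' Set.range b := by
      rw [← Set.range_comp]
      rfl
    rw [h2, ← h1]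
    rfl
  · rw [Finset.coe_image, ← hΛ]
    exact Set.image_mono hS
  · rw [Finset.coe_image, ← hP]
    exact (T : V →ₗ[ℝ] V').image_convexHull _

theorem mainTheorem5 (n r k : ℕ) (hr : 0 < r) (hrn : r < n) (hk : k = n - r) :
    (Function.Injective (Ladder.primitiveDualVertex (r := r) (k := k)) ∧
      Set.range (Ladder.primitiveDualVertex (r := r) (k := k)) =
        (dualPolytope (Ladder.gelfandCetlinPolytope r k)).extremePoints ℝ) ∧
    LatticePolytopesIsomorphic
      (Ladder.standardLattice r k)
      (Ladder.gelfandCetlinPolytope r k)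
      (primitiveDualLattice (Ladder.gelfandCetlinPolytope r k))
      (Ladder.truncatedPrimitiveDual r k) := by
  have hk0 : 0 < k := by omega
  have hP := Ladder.isLatticePolytope_gelfandCetlinPolytope (r := r) (k := k)
  have hΛ := Ladder.mirrorEquiv_image_standardLattice (k := k) hr
  have hQ := Ladder.mirrorEquiv_image_polytope (k := k) hr
  rw [Ladder.primitiveDualLattice_eq_arrowLattice hr hk0]
  exact ⟨⟨Ladder.primitiveDualVertex_injective hr, Ladder.range_primitiveDualVertex hr⟩,
    hP, hP.map _ hΛ hQ, _, hΛ, hQ⟩
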